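/- For a metric space $X$ and $x,y,z\in X$ let $(y,z)_x=\frac12\big(d(x,y)+d(x,z)-d(y,z)\big)$. The space $X$ is $\delta$-hyperbolic ($\delta\ge 0$) if $(x,z)_w\ge\min\{(x,y)_w,(y,z)_w\}-\delta$ for all $x,y,z,w\in X$. It is $K$-almost geodesic if for all $x,y\in X$ and all $t\in[0,d(x,y)]$ there is $z\in X$ with $|d(x,z)-t|\le K$ and $|d(y,z)-(d(x,y)-t)|\le K$. It is geodesic if it is $0$-almost geodesic (for proper spaces this is equivalent to the existence of a geodesic segment between any two points). The Gromov boundary $\partial X$ of a $\delta$-hyperbolic space $X$ is the set of sequences $(z_n)$ in $X$ with $\lim_{n,m\to+\infty}(z_n,z_m)_x=+\infty$, modulo the relation $(z_n)\approx(z_n')$ if and only if $\lim_{n,m\to+\infty}(z_n,z_m')_x=+\infty$. For $z,z'\in\partial X$ put $(z,z')_x=\sup\liminf_{n,m\to+\infty}(z_n,z_m')_x\in[0,+\infty]$, the supremum being over all sequences $(z_n)\in z$ and $(z'_n)\in z'$. The set $\partial X$ carries its natural topology, in which the sets $\{z' : (z,z')_x>r\}$, $r\in\mathbb R$, form a basis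 of neighborhoods of $z$. The quasiconvex hull $\textup{QC-Hull}(C)\subseteq X$ of a subset $C\subseteq\partial X$ is the union of all geodesic lines $\gamma\colon\mathbb R\to X$ whose endpoints $\gamma^\pm=[(\gamma(\pm n))_n]$ belong to $C$; it is equipped with the restriction of the metric of $X$. A homeomorphism $F\colon(Y,d)\to(Y',d')$ of metric spaces is a quasisymmetric equivalence if there is an increasing homeomorphism $\eta\colon[0,+\infty)\to[0,+\infty)$ such that $$\frac{d'(F(y),F(y'))}{d'(F(y),F(y''))}\le\eta\left(\frac{d(y,y')}{d(y,y'')}\right)$$ for all $y,y',y''\in Y$ with $d(y,y'')>0$. A visual metric on the boundary of a $\delta$-hyperbolic space $X$ is a metric $D$ on $\partial X$ for which there exist a center $x\in X$, a parameter $a\in\left(0,\frac{1}{2\delta\log_2 e}\right)$ (any $a>0$ if $\delta=0$) and $V>0$ such that $\frac1Ve^{-a(z,z')_x}\le D(z,z')\le Ve^{-a(z,z')_x}$ for all $z,z'\in\partial X$. The gauge $\mathcal J(\partial X)$ is the set of all metrics on $\partial X$ that are quasisymmetrically equivalent, through the identity map, to a visual metric. For $C\subseteq\partial X$, the gauge $\mathcal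 J(C)$ is the set of all metrics on $C$ that are quasisymmetrically equivalent, through the identity map, to the restriction to $C$ of a visual metric on $\partial X$. **Proposition.** Let $X$ be a proper, geodesic, $\delta$-hyperbolic metric space and let $C\subseteq\partial X$ be a closed subset with at least two points. Then $\textup{QC-Hull}(C)$ is proper, $36\delta$-almost geodesic and $\delta$-hyperbolic. Moreover $\mathcal J(\partial\,\textup{QC-Hull}(C))\cong\mathcal J(C)$, in the following sense: both gauges are non-empty, and there exists a homeomorphism $F\colon C\to\partial\,\textup{QC-Hull}(C)$ which is a quasisymmetric equivalence from $(C,d)$ to $(\partial\,\textup{QC-Hull}(C),d')$ for every metric $d\in\mathcal J(C)$ and every metric $d'\in\mathcal J(\partial\,\textup{QC-Hull}(C))$. -/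

import Mathlib

open Filter Topology
open scoped NNReal

universe u v

/-! ### Gromov products, hyperbolicity, almost geodesic spaces -/

/-- The Gromov product `(y, z)_x` of `y` and `z` with respect to `x`. -/
noncomputable def gromovProduct {X : Type u} [MetricSpace X] (x y z : X) : ℝ :=
  (dist x y + dist x z - dist y z) / 2

/-- `X` is `δ`-hyperbolic (with `δ ≥ 0`): the 4-points condition. -/
def IsGromovHyperbolic (δ : ℝ) (X : Type u) [MetricSpace X] : Prop :=
  0 ≤ δ ∧ ∀ x y z w : X,
    min (gromovProduct w x y) (gromovProduct w y z) - δ ≤ gromovProduct w x z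

/-- `X` is `K`-almost geodesic. -/
def IsAlmostGeodesic (K : ℝ) (X : Type u) [MetricSpace X] : Prop :=
  ∀ x y : X, ∀ t ∈ Set.Icc (0 : ℝ) (dist x y),
    ∃ z : X, |dist x z - t| ≤ K ∧ |dist y z - (dist x y - t)| ≤ K

/-- `X` is geodesic: it is `0`-almost geodesic. (For proper spaces this is the same as asking
that any two points are joined by a geodesic segment.) -/
def IsGeodesicSpace (X : Type u) [MetricSpace X] : Prop :=
  IsAlmostGeodesic 0 X

/-! ### The Gromov boundary -/

/-- `(u_n, v_m)_x → +∞` as `n, m → +∞`. This does not depend on the basepoint `x`; in order not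
to choose one, we ask it for all of them. -/
def GromovProductsTendTo {X : Type u} [MetricSpace X] (s t : ℕ → X) : Prop :=
  ∀ x : X, Tendsto (fun p : ℕ × ℕ => gromovProduct x (s p.1) (t p.2)) atTop atTop

/-- The sequences of points of `X` that define points of the Gromov boundary. -/
def GromovSequence (X : Type u) [MetricSpace X] : Type u :=
  {s : ℕ → X // GromovProductsTendTo s s}

/-- The relation `≈` on these sequences. -/
def gromovRel {X : Type u} [MetricSpace X] (s t : GromovSequence X) : Prop :=
  GromovProductsTendTo s.1 t.1

/-- The Gromov boundary `∂X`. When `X` is Gromov hyperbolic, `gromovRel` is an equivalence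
relation, by `gromovRel_equivalence` below. -/
def GromovBoundary (X : Type u) [MetricSpace X] : Type u :=
  Quot (gromovRel (X := X))

theorem gromovProduct_comm {X : Type u} [MetricSpace X] (x y z : X) :
    gromovProduct x y z = gromovProduct x z y := by
  unfold gromovProduct
  rw [dist_comm y z]
  ring

theorem gromovRel_equivalence {δ : ℝ} {X : Type u} [MetricSpace X]
    (hX : IsGromovHyperbolic δ X) : Equivalence (gromovRel (X := X)) where
  refl s := s.2
  symm := by
    intro s t h x
    have h0 : Tendsto (fun p : ℕ × ℕ => (p.2, p.1)) atTop atTop := by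
      rw [← prod_atTop_atTop_eq]
      exact tendsto_snd.prodMk tendsto_fst
    have h1 := (h x).comp h0
    refine h1.congr fun p => ?_
    exact gromovProduct_comm _ _ _
  trans := by
    intro s t r hst htr x
    rw [tendsto_atTop]
    intro b
    obtain ⟨⟨n₁, k₁⟩, h₁⟩ := eventually_atTop.1 ((tendsto_atTop.1 (hst x)) (b + δ))
    obtain ⟨⟨k₂, m₁⟩, h₂⟩ := eventually_atTop.1 ((tendsto_atTop.1 (htr x)) (b + δ))
    refine eventually_atTop.2 ⟨(n₁, m₁), fun p hp => ?_⟩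
    have e₁ := h₁ (p.1, max k₁ k₂) ⟨hp.1, le_max_left _ _⟩
    have e₂ := h₂ (max k₁ k₂, p.2) ⟨le_max_right _ _, hp.2⟩
    have e₃ := hX.2 (s.1 p.1) (t.1 (max k₁ k₂)) (r.1 p.2) x
    have e₄ := le_min e₁ e₂
    linarith

/-- The sequence `s` of points of `X` converges to the boundary point `z`, i.e. it is a
representative of `z`. -/
def ConvergesToBoundary {X : Type u} [MetricSpace X] (s : ℕ → X) (z : GromovBoundary X) : Prop :=
  ∃ h : GromovProductsTendTo s s, (Quot.mk gromovRel ⟨s, h⟩ : GromovBoundary X) = z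

/-- The Gromov product `(z, z')_x` of two boundary points, an extended real number: the supremum
of `liminf_{n,m} (z_n, z'_m)_x` over all sequences representing `z` and `z'`. -/
noncomputable def boundaryGromovProduct {X : Type u} [MetricSpace X] (x : X)
    (z z' : GromovBoundary X) : EReal :=
  ⨆ (s : ℕ → X) (t : ℕ → X) (_ : ConvergesToBoundary s z) (_ : ConvergesToBoundary t z'),
    liminf (fun p : ℕ × ℕ => ((gromovProduct x (s p.1) (t p.2) : ℝ) : EReal)) atTop

/-- The natural topology of the Gromov boundary: the sets `{z' | r < (z, z')_x}`, `r` real, form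
a basis of neighborhoods of `z`. -/
instance gromovBoundaryTopology (X : Type u) [MetricSpace X] :
    TopologicalSpace (GromovBoundary X) where
  IsOpen U := ∀ x : X, ∀ z ∈ U, ∃ r : ℝ, ∀ z' : GromovBoundary X,
    (r : EReal) < boundaryGromovProduct x z z' → z' ∈ U
  isOpen_univ := fun _ _ _ => ⟨0, fun _ _ => trivial⟩
  isOpen_inter := by
    intro U V hU hV x z hz
    obtain ⟨r₁, h₁⟩ := hU x z hz.1
    obtain ⟨r₂, h₂⟩ := hV x z hz.2
    refine ⟨max r₁ r₂, fun z' hz' => ⟨h₁ z' (lt_of_le_of_lt ?_ hz'), h₂ z' (lt_of_le_of_lt ?_ hz')⟩⟩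
    · exact EReal.coe_le_coe_iff.2 (le_max_left _ _)
    · exact EReal.coe_le_coe_iff.2 (le_max_right _ _)
  isOpen_sUnion := by
    intro S hS x z hz
    obtain ⟨U, hU, hzU⟩ := hz
    obtain ⟨r, hr⟩ := hS U hU x z hzU
    exact ⟨r, fun z' hz' => ⟨U, hU, hr z' hz'⟩⟩

/-! ### Quasisymmetric equivalences and gauges -/

/-- `F` is a quasisymmetric equivalence: a homeomorphism which satisfies the quasisymmetry
inequality for some increasing homeomorphism `η` of `[0, +∞)`. (The order isomorphisms of `ℝ≥0`
are exactly its increasing self-homeomorphisms, and they fix `0`.) -/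
def IsQuasisymmetricEquivalence {α : Type u} {β : Type v} [MetricSpace α] [MetricSpace β]
    (F : α → β) : Prop :=
  IsHomeomorph F ∧ ∃ η : ℝ≥0 ≃o ℝ≥0, ∀ x x' x'' : α, 0 < dist x x'' →
    nndist (F x) (F x') / nndist (F x) (F x'') ≤ η (nndist x x' / nndist x x'')

/-- The quasisymmetric gauge of a metric `d` on `α`: all the metrics on the set `α` that are
quasisymmetric equivalent to `d` through the identity map. -/
def quasisymmetricGauge {α : Type u} (d : MetricSpace α) : Set (MetricSpace α) :=
  {d' | @IsQuasisymmetricEquivalence α α d' d id}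

/-- `D` is a visual metric of center `x` and parameter `a` on the boundary of the `δ`-hyperbolic
space `X`, where `0 < a < 1 / (2 δ log₂ e)` (so `a` is any positive number if `δ = 0`). -/
def IsVisualMetric (δ : ℝ) {X : Type u} [MetricSpace X] (x : X) (a : ℝ)
    (D : MetricSpace (GromovBoundary X)) : Prop :=
  0 < a ∧ a * (2 * δ * Real.logb 2 (Real.exp 1)) < 1 ∧
    ∃ V : ℝ, 0 < V ∧ ∀ z z' : GromovBoundary X,
      1 / V * (EReal.exp (-((a : EReal) * boundaryGromovProduct x z z'))).toReal ≤ D.dist z z' ∧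
      D.dist z z' ≤ V * (EReal.exp (-((a : EReal) * boundaryGromovProduct x z z'))).toReal

/-- The gauge `𝒥(∂X)` of the boundary of the `δ`-hyperbolic space `X`: the metrics that are
quasisymmetric equivalent to a visual metric. -/
def boundaryGauge (δ : ℝ) (X : Type u) [MetricSpace X] : Set (MetricSpace (GromovBoundary X)) :=
  {d | ∃ (x : X) (a : ℝ) (D : MetricSpace (GromovBoundary X)),
    IsVisualMetric δ x a D ∧ d ∈ quasisymmetricGauge D}

/-- The gauge `𝒥(C)` of a subset `C` of the boundary of the `δ`-hyperbolic space `X`: the metrics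
on `C` that are quasisymmetric equivalent to the restriction to `C` of a visual metric. -/
def subsetGauge (δ : ℝ) {X : Type u} [MetricSpace X] (C : Set (GromovBoundary X)) :
    Set (MetricSpace C) :=
  {d | ∃ (x : X) (a : ℝ) (D : MetricSpace (GromovBoundary X)),
    IsVisualMetric δ x a D ∧
      d ∈ quasisymmetricGauge (MetricSpace.induced Subtype.val Subtype.val_injective D)}

/-! ### The quasiconvex hull -/

/-- `γ` is a geodesic line of `X` with positive endpoint `z` and negative endpoint `z'`. -/
def IsGeodesicLineJoining {X : Type u} [MetricSpace X] (γ : ℝ → X)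
    (z z' : GromovBoundary X) : Prop :=
  Isometry γ ∧ ConvergesToBoundary (fun n : ℕ => γ (n : ℝ)) z ∧
    ConvergesToBoundary (fun n : ℕ => γ (-(n : ℝ))) z'

/-- The quasiconvex hull of `C`: the union of all the geodesic lines joining two points of `C`.
(In a Gromov hyperbolic space the two endpoints of a geodesic line are always different.) -/
def qcHull {X : Type u} [MetricSpace X] (C : Set (GromovBoundary X)) : Set X :=
  {p | ∃ (γ : ℝ → X) (z z' : GromovBoundary X),
    z ∈ C ∧ z' ∈ C ∧ IsGeodesicLineJoining γ z z' ∧ p ∈ Set.range γ}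

/-!
Everything rests on the four-point condition applied to sequences representing boundary points, and
on compactness of closed balls of `X`.

*The hull.* Ultralimits of almost isometric maps (`exists_isometric_ultralimit`) produce geodesic
segments and lines. In particular two distinct boundary points are joined by a line
(`IsGeodesicSpace.exists_isGeodesicLineJoining`), and a limit of lines with endpoints in the closed
set `C` is a line with endpoints in `C`, so the hull is closed in `X` (`isClosed_qcHull`) and
therefore proper. If `m` lies between two points `p`, `q` of the hull, then going from `p` to `q`
through infinity (along a line through `p`, a line between two ends, a line through `q`) shows that
`m` is within `6δ` of one of these three lines (`exists_mem_qcHull_dist_le`); this gives more than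
the required `36δ`-almost geodesicity. Hyperbolicity is inherited by every subspace.

*The boundary.* The inclusion of the hull in `X` induces an injection of boundaries, whose image is
`C` (`range_boundaryInclusion_qcHull`). It changes Gromov products of boundary points by a bounded
amount only, so in terms of visual metrics of parameters `a` and `a'` the resulting bijection
`C ≃ ∂ QC-Hull(C)` is bi-Lipschitz after replacing `D` by the snowflake `D ^ (a' / a)`
(`isQuasisymmetricEquivalence_of_isVisualMetric`). Snowflakes are quasisymmetric, and
quasisymmetric equivalences compose and invert, which extends the conclusion to all metrics of both
gauges. Visual metrics exist by Frink's metrization lemma (`exists_isVisualMetric`), hence the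
gauges are non-empty; they induce the natural topology (`IsVisualMetric.toTopologicalSpace_eq`),
hence the bijection is a homeomorphism for the natural topologies.
-/

/-! ### Gromov products and sequences converging to the boundary -/

section Basic

variable {X : Type u} [MetricSpace X] {δ : ℝ}

lemma gromovProduct_nonneg (x y z : X) : 0 ≤ gromovProduct x y z := by
  have := dist_triangle_left y z x
  unfold gromovProduct
  linarith

lemma gromovProduct_le_add_dist (x x' y z : X) :
    gromovProduct x y z ≤ gromovProduct x' y z + dist x x' := by
  have h₁ := dist_triangle x x' y
  have h₂ := dist_triangle x x' z
  unfold gromovProduct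
  linarith

lemma gromovProduct_self (x y : X) : gromovProduct x y y = dist x y := by
  simp [gromovProduct]

lemma IsGromovHyperbolic.le_trans (hX : IsGromovHyperbolic δ X) {w x y z : X} {r : ℝ}
    (h₁ : r ≤ gromovProduct w x y) (h₂ : r ≤ gromovProduct w y z) :
    r - δ ≤ gromovProduct w x z :=
  (sub_le_sub_right (le_min h₁ h₂) δ).trans (hX.2 x y z w)

lemma IsGromovHyperbolic.le_trans₃ (hX : IsGromovHyperbolic δ X) {w x₁ x₂ x₃ x₄ : X} {r : ℝ}
    (h₁ : r ≤ gromovProduct w x₁ x₂) (h₂ : r ≤ gromovProduct w x₂ x₃)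
    (h₃ : r ≤ gromovProduct w x₃ x₄) : r - 2 * δ ≤ gromovProduct w x₁ x₄ := by
  have h₄ := hX.le_trans h₁ h₂
  have h₅ := hX.le_trans h₄ (by linarith [hX.1] : r - δ ≤ gromovProduct w x₃ x₄)
  linarith

/-- The point `r` of a geodesic from `p` to `b` at distance `(m, b)_p` from `p` satisfies
`(p, m)_r = (m, b)_r`, so that the four-point condition at `r` bounds both products by `δ`. -/
lemma IsGromovHyperbolic.dist_le_gromovProduct_add (hX : IsGromovHyperbolic δ X) {p b m r : X}
    (h₁ : dist p r = gromovProduct p m b) (h₂ : dist r b = dist p b - gromovProduct p m b) :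
    dist m r ≤ gromovProduct m p b + 2 * δ := by
  have h := hX.2 p m b r
  have e : gromovProduct r p m = gromovProduct r m b := by
    unfold gromovProduct at *
    rw [dist_comm r p]
    linarith
  rw [← e, min_self] at h
  unfold gromovProduct at *
  rw [dist_comm r p, dist_comm r m] at h
  rw [dist_comm m p]
  linarith

lemma gromovProductsTendTo_iff (x : X) {s t : ℕ → X} :
    GromovProductsTendTo s t ↔
      ∀ R : ℝ, ∃ N, ∀ n ≥ N, ∀ m ≥ N, R ≤ gromovProduct x (s n) (t m) := by
  constructor
  · intro h R
    obtain ⟨⟨a, b⟩, hab⟩ := eventually_atTop.1 (tendsto_atTop.1 (h x) R)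
    exact ⟨max a b, fun n hn m hm =>
      hab (n, m) ⟨(le_max_left _ _).trans hn, (le_max_right _ _).trans hm⟩⟩
  · intro h y
    refine tendsto_atTop.2 fun R => ?_
    obtain ⟨N, hN⟩ := h (R + dist x y)
    refine eventually_atTop.2 ⟨(N, N), fun p hp => ?_⟩
    linarith [hN p.1 hp.1 p.2 hp.2, gromovProduct_le_add_dist x y (s p.1) (t p.2)]

lemma GromovProductsTendTo.symm {s t : ℕ → X} (h : GromovProductsTendTo s t) :
    GromovProductsTendTo t s := by
  rw [gromovProductsTendTo_iff (s 0)] at h ⊢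
  intro R
  obtain ⟨N, hN⟩ := h R
  exact ⟨N, fun n hn m hm => by rw [gromovProduct_comm]; exact hN m hm n hn⟩

lemma GromovProductsTendTo.trans (hX : IsGromovHyperbolic δ X) {s t r : ℕ → X}
    (h : GromovProductsTendTo s t) (h' : GromovProductsTendTo t r) :
    GromovProductsTendTo s r := by
  rw [gromovProductsTendTo_iff (s 0)] at h h' ⊢
  intro R
  obtain ⟨N, hN⟩ := h (R + δ)
  obtain ⟨M, hM⟩ := h' (R + δ)
  refine ⟨max N M, fun n hn m hm => ?_⟩
  have := hX.le_trans (hN n ((le_max_left _ _).trans hn) (max N M) (le_max_left _ _))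
    (hM (max N M) (le_max_right _ _) m ((le_max_right _ _).trans hm))
  linarith

lemma exists_convergesToBoundary (z : GromovBoundary X) : ∃ s, ConvergesToBoundary s z := by
  induction z using Quot.ind with
  | mk s => exact ⟨s.1, s.2, rfl⟩

lemma ConvergesToBoundary.gromovProductsTendTo (hX : IsGromovHyperbolic δ X) {s t : ℕ → X}
    {z : GromovBoundary X} (hs : ConvergesToBoundary s z) (ht : ConvergesToBoundary t z) :
    GromovProductsTendTo s t := by
  obtain ⟨h, rfl⟩ := hs
  obtain ⟨h', e⟩ := ht
  exact ((gromovRel_equivalence hX).eqvGen_iff.1 (Quot.eqvGen_exact e)).symm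

lemma ConvergesToBoundary.congr (hX : IsGromovHyperbolic δ X) {s t : ℕ → X}
    {z : GromovBoundary X} (hs : ConvergesToBoundary s z) (h : GromovProductsTendTo s t) :
    ConvergesToBoundary t z := by
  obtain ⟨h', rfl⟩ := hs
  exact ⟨h.symm.trans hX h, Quot.sound h.symm⟩

lemma ConvergesToBoundary.unique {s t : ℕ → X} {z z' : GromovBoundary X}
    (hs : ConvergesToBoundary s z) (ht : ConvergesToBoundary t z')
    (h : GromovProductsTendTo s t) : z = z' := by
  obtain ⟨h', rfl⟩ := hs
  obtain ⟨h'', rfl⟩ := ht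
  exact Quot.sound h

lemma le_boundaryGromovProduct {s t : ℕ → X} {z z' : GromovBoundary X}
    (hs : ConvergesToBoundary s z) (ht : ConvergesToBoundary t z') {x : X} {r : ℝ} {N : ℕ}
    (h : ∀ n ≥ N, ∀ m ≥ N, r ≤ gromovProduct x (s n) (t m)) :
    (r : EReal) ≤ boundaryGromovProduct x z z' := by
  refine le_iSup_of_le s (le_iSup_of_le t (le_iSup_of_le hs (le_iSup_of_le ht ?_)))
  refine le_liminf_of_le (by isBoundedDefault) ?_
  exact eventually_atTop.2 ⟨(N, N), fun p hp => EReal.coe_le_coe_iff.2 (h p.1 hp.1 p.2 hp.2)⟩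

/-- Changing the sequences representing two boundary points lowers the inferior limit of their
Gromov products by at most `2δ`. -/
lemma exists_le_gromovProduct (hX : IsGromovHyperbolic δ X) {s t : ℕ → X}
    {z z' : GromovBoundary X} (hs : ConvergesToBoundary s z) (ht : ConvergesToBoundary t z')
    {x : X} {r : ℝ} (h : (r : EReal) < boundaryGromovProduct x z z') :
    ∃ N, ∀ n ≥ N, ∀ m ≥ N, r - 2 * δ ≤ gromovProduct x (s n) (t m) := by
  simp only [boundaryGromovProduct, lt_iSup_iff] at h
  obtain ⟨s', t', hs', ht', h⟩ := h
  obtain ⟨⟨a, b⟩, hab⟩ := eventually_atTop.1 (eventually_lt_of_lt_liminf h)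
  obtain ⟨N₁, h₁⟩ := (gromovProductsTendTo_iff x).1 (hs.gromovProductsTendTo hX hs') r
  obtain ⟨N₂, h₂⟩ := (gromovProductsTendTo_iff x).1 (ht'.gromovProductsTendTo hX ht) r
  refine ⟨max N₁ N₂, fun n hn m hm => ?_⟩
  exact hX.le_trans₃
    (h₁ n ((le_max_left _ _).trans hn) (max a N₁) (le_max_right _ _))
    (EReal.coe_lt_coe_iff.1 (hab (max a N₁, max b N₂) ⟨le_max_left _ _, le_max_left _ _⟩)).le
    (h₂ (max b N₂) (le_max_right _ _) m ((le_max_right _ _).trans hm))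

lemma boundaryGromovProduct_nonneg (x : X) (z z' : GromovBoundary X) :
    0 ≤ boundaryGromovProduct x z z' := by
  obtain ⟨s, hs⟩ := exists_convergesToBoundary z
  obtain ⟨t, ht⟩ := exists_convergesToBoundary z'
  exact le_boundaryGromovProduct hs ht (N := 0) fun n _ m _ => gromovProduct_nonneg _ _ _

lemma boundaryGromovProduct_comm (x : X) (z z' : GromovBoundary X) :
    boundaryGromovProduct x z z' = boundaryGromovProduct x z' z := by
  have key : ∀ z z' : GromovBoundary X,
      boundaryGromovProduct x z z' ≤ boundaryGromovProduct x z' z := by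
    intro z z'
    refine EReal.ge_of_forall_gt_iff_ge.1 fun r hr => ?_
    simp only [boundaryGromovProduct, lt_iSup_iff] at hr
    obtain ⟨s, t, hs, ht, h⟩ := hr
    obtain ⟨⟨a, b⟩, hab⟩ := eventually_atTop.1 (eventually_lt_of_lt_liminf h)
    refine le_boundaryGromovProduct ht hs (N := max a b) fun n hn m hm => ?_
    rw [gromovProduct_comm]
    exact (EReal.coe_lt_coe_iff.1
      (hab (m, n) ⟨(le_max_left _ _).trans hm, (le_max_right _ _).trans hn⟩)).le
  exact le_antisymm (key z z') (key z' z)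

lemma boundaryGromovProduct_eq_top_iff (hX : IsGromovHyperbolic δ X) {x : X}
    {z z' : GromovBoundary X} : boundaryGromovProduct x z z' = ⊤ ↔ z = z' := by
  obtain ⟨s, hs⟩ := exists_convergesToBoundary z
  obtain ⟨t, ht⟩ := exists_convergesToBoundary z'
  constructor
  · intro h
    refine hs.unique ht ((gromovProductsTendTo_iff x).2 fun R => ?_)
    obtain ⟨N, hN⟩ := exists_le_gromovProduct hX hs ht (x := x) (r := R + 2 * δ)
      (h ▸ EReal.coe_lt_top _)
    exact ⟨N, fun n hn m hm => by linarith [hN n hn m hm]⟩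
  · rintro rfl
    refine EReal.eq_top_iff_forall_lt _ |>.2 fun R => ?_
    obtain ⟨N, hN⟩ := (gromovProductsTendTo_iff x).1 (hs.gromovProductsTendTo hX hs) (R + 1)
    exact (EReal.coe_lt_coe_iff.2 (lt_add_one R)).trans_le (le_boundaryGromovProduct hs hs hN)

lemma le_boundaryGromovProduct_of_lt (hX : IsGromovHyperbolic δ X) (x x' : X)
    {z z' : GromovBoundary X} {r : ℝ} (h : (r : EReal) < boundaryGromovProduct x z z') :
    ((r - (2 * δ + dist x x') : ℝ) : EReal) ≤ boundaryGromovProduct x' z z' := by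
  obtain ⟨s, hs⟩ := exists_convergesToBoundary z
  obtain ⟨t, ht⟩ := exists_convergesToBoundary z'
  obtain ⟨N, hN⟩ := exists_le_gromovProduct hX hs ht h
  refine le_boundaryGromovProduct hs ht (N := N) fun n hn m hm => ?_
  linarith [hN n hn m hm, gromovProduct_le_add_dist x x' (s n) (t m)]

/-- A point of the boundary which has arbitrarily large Gromov products with points of a closed
set belongs to this set. -/
lemma IsClosed.mem_of_gromovProduct_large
    {C : Set (GromovBoundary X)} (hC : IsClosed C) (x : X) {z : GromovBoundary X}
    (h : ∀ r : ℝ, ∃ z' ∈ C, (r : EReal) < boundaryGromovProduct x z z') : z ∈ C := by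
  by_contra hz
  obtain ⟨r, hr⟩ := hC.isOpen_compl x z hz
  obtain ⟨z', hz', h'⟩ := h r
  exact hr z' h' hz'

end Basic

/-! ### Quasisymmetric equivalences -/

section Quasisymmetric

lemma IsQuasisymmetricEquivalence.id (α : Type u) [MetricSpace α] :
    IsQuasisymmetricEquivalence (id : α → α) :=
  ⟨(Homeomorph.refl α).isHomeomorph, OrderIso.refl _, fun _ _ _ _ => le_rfl⟩

lemma IsQuasisymmetricEquivalence.comp {α : Type*} {β : Type*} {γ : Type*}
    [MetricSpace α] [MetricSpace β] [MetricSpace γ] {G : β → γ} {F : α → β}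
    (hG : IsQuasisymmetricEquivalence G) (hF : IsQuasisymmetricEquivalence F) :
    IsQuasisymmetricEquivalence (G ∘ F) := by
  obtain ⟨hG₀, η₂, h₂⟩ := hG
  obtain ⟨hF₀, η₁, h₁⟩ := hF
  refine ⟨hG₀.comp hF₀, η₁.trans η₂, fun x x' x'' hx => ?_⟩
  have hx' : 0 < dist (F x) (F x'') :=
    dist_pos.2 fun e => dist_pos.1 hx (hF₀.injective e)
  exact (h₂ _ _ _ hx').trans (η₂.monotone (h₁ _ _ _ hx))

/-- The order isomorphism `t ↦ 1 / η⁻¹(1 / t)` of `ℝ≥0`, which controls the inverse of a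
quasisymmetric equivalence controlled by `η`. The convention `1 / 0 = 0` and `η 0 = 0` make the
formula correct at `0`. -/
noncomputable def invConjSymm (η : ℝ≥0 ≃o ℝ≥0) : ℝ≥0 ≃o ℝ≥0 where
  toFun t := (η.symm t⁻¹)⁻¹
  invFun t := (η t⁻¹)⁻¹
  left_inv t := by simp
  right_inv t := by simp
  map_rel_iff' := by
    intro s t
    have h0 : η.symm 0 = 0 := η.symm.map_bot
    change (η.symm s⁻¹)⁻¹ ≤ (η.symm t⁻¹)⁻¹ ↔ s ≤ t
    have hpos : ∀ {u : ℝ≥0}, 0 < u → 0 < η.symm u⁻¹ := fun {u} hu => by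
      rw [← h0]; exact η.symm.strictMono (inv_pos.2 hu)
    rcases eq_zero_or_pos s with rfl | hs
    · simp [h0]
    rcases eq_zero_or_pos t with rfl | ht
    · simp [h0, hs.ne', (hpos hs).ne']
    rw [inv_le_inv₀ (hpos hs) (hpos ht), η.symm.le_iff_le, inv_le_inv₀ ht hs]

lemma IsQuasisymmetricEquivalence.symm {α : Type*} {β : Type*} [MetricSpace α] [MetricSpace β]
    {F : α ≃ β} (hF : IsQuasisymmetricEquivalence F) :
    IsQuasisymmetricEquivalence F.symm := by
  obtain ⟨hF₀, η, h⟩ := hF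
  have hF₁ := F.isHomeomorph_iff.1 hF₀
  refine ⟨F.symm.isHomeomorph_iff.2 ⟨hF₁.2, hF₁.1⟩, invConjSymm η, fun y y' y'' hy => ?_⟩
  obtain ⟨x, rfl⟩ := F.surjective y
  obtain ⟨x', rfl⟩ := F.surjective y'
  obtain ⟨x'', rfl⟩ := F.surjective y''
  simp only [Equiv.symm_apply_apply]
  rcases eq_or_ne x x' with rfl | hx'
  · simp
  have hd : 0 < nndist x x' := by simpa [← NNReal.coe_pos] using hx'
  have hx : x ≠ x'' := fun e => dist_pos.1 hy (congrArg F e)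
  have hd' : 0 < nndist x x'' := by simpa [← NNReal.coe_pos] using hx
  have key := h x x'' x' (dist_pos.2 hx')
  change _ ≤ (η.symm (nndist (F x) (F x') / nndist (F x) (F x''))⁻¹)⁻¹
  rw [inv_div]
  have k := η.symm.monotone key
  rw [η.symm_apply_apply] at k
  have hpos : 0 < η.symm (nndist (F x) (F x'') / nndist (F x) (F x')) := by
    rw [← show η.symm 0 = 0 from η.symm.map_bot]
    refine η.symm.strictMono (div_pos ?_ ?_) <;> simp [← NNReal.coe_pos, hx, hx']
  rw [← inv_div]
  exact (inv_le_inv₀ (div_pos hd' hd) hpos).2 k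

/-- A bijection which is bi-Lipschitz from the snowflake `d ^ p` is a quasisymmetric equivalence,
with `η(t) = K² t ^ p`. -/
lemma IsQuasisymmetricEquivalence.of_rpow {α : Type*} {β : Type*} [MetricSpace α] [MetricSpace β]
    (F : α ≃ β) {p K : ℝ} (hp : 0 < p) (hK : 0 < K)
    (h : ∀ x y, dist (F x) (F y) ≤ K * dist x y ^ p)
    (h' : ∀ x y, dist x y ^ p ≤ K * dist (F x) (F y)) :
    IsQuasisymmetricEquivalence F := by
  constructor
  · refine F.isHomeomorph_iff.2 ⟨?_, ?_⟩
    · refine continuous_iff_continuousAt.2 fun x => tendsto_iff_dist_tendsto_zero.2 ?_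
      refine squeeze_zero (fun _ => dist_nonneg) (fun y => h y x) ?_
      have c : Continuous fun y => K * dist y x ^ p :=
        continuous_const.mul ((continuous_id.dist continuous_const).rpow_const
          fun _ => Or.inr hp.le)
      simpa [hp.ne'] using c.tendsto x
    · refine continuous_iff_continuousAt.2 fun x => tendsto_iff_dist_tendsto_zero.2 ?_
      refine squeeze_zero (g := fun y => (K * dist y x) ^ p⁻¹) (fun _ => dist_nonneg)
        (fun y => ?_) ?_
      · have := h' (F.symm y) (F.symm x)
        rw [F.apply_symm_apply, F.apply_symm_apply] at this
        exact (Real.le_rpow_inv_iff_of_pos dist_nonneg (mul_nonneg hK.le dist_nonneg) hp).2 this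
      · have c : Continuous fun y => (K * dist y x) ^ p⁻¹ :=
          (continuous_const.mul (continuous_id.dist continuous_const)).rpow_const
            fun _ => Or.inr (inv_pos.2 hp).le
        simpa [hp.ne'] using c.tendsto x
  · refine ⟨(NNReal.orderIsoRpow p hp).trans (OrderIso.mulLeft₀ (Real.toNNReal K ^ 2)
      (pow_pos (Real.toNNReal_pos.2 hK) 2)), fun x x' x'' hx => ?_⟩
    have hx'' : 0 < dist (F x) (F x'') :=
      dist_pos.2 fun e => dist_pos.1 hx (F.injective e)
    rw [← NNReal.coe_le_coe]
    simp only [OrderIso.trans_apply, NNReal.orderIsoRpow_apply, OrderIso.mulLeft₀_apply,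
      NNReal.coe_div, coe_nndist, NNReal.coe_mul, NNReal.coe_pow, NNReal.coe_rpow,
      Real.coe_toNNReal K hK.le]
    rw [Real.div_rpow dist_nonneg dist_nonneg, ← mul_div_assoc,
      div_le_div_iff₀ hx'' (Real.rpow_pos_of_pos hx p)]
    calc dist (F x) (F x') * dist x x'' ^ p
        ≤ (K * dist x x' ^ p) * (K * dist (F x) (F x'')) :=
          mul_le_mul (h _ _) (h' _ _) (Real.rpow_nonneg dist_nonneg _)
            (mul_nonneg hK.le (Real.rpow_nonneg dist_nonneg _))
      _ = K ^ 2 * dist x x' ^ p * dist (F x) (F x'') := by ring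

end Quasisymmetric

/-! ### Visual metrics -/

/-- The real number `exp (-a b)`, equal to `0` when `a > 0` and `b = ⊤`. -/
noncomputable def expDecay (a : ℝ) (b : EReal) : ℝ := (EReal.exp (-((a : EReal) * b))).toReal

section ExpDecay

variable {a a' r c : ℝ} {b b' : EReal}

lemma expDecay_nonneg : 0 ≤ expDecay a b := ENNReal.toReal_nonneg

lemma expDecay_top (ha : 0 < a) : expDecay a ⊤ = 0 := by
  simp [expDecay, EReal.coe_mul_top_of_pos ha]

lemma expDecay_coe (a r : ℝ) : expDecay a (r : EReal) = Real.exp (-(a * r)) := by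
  rw [expDecay, ← EReal.coe_mul, ← EReal.coe_neg, EReal.exp_coe,
    ENNReal.toReal_ofReal (Real.exp_pos _).le]

lemma expDecay_eq_zero_iff (ha : 0 < a) (hb : 0 ≤ b) : expDecay a b = 0 ↔ b = ⊤ := by
  induction b with
  | bot => simp at hb
  | top => simp [expDecay_top ha]
  | coe r => simp [expDecay_coe, (Real.exp_pos _).ne']

lemma expDecay_lt_exp_iff (ha : 0 < a) (hb : 0 ≤ b) :
    expDecay a b < Real.exp (-(a * r)) ↔ (r : EReal) < b := by
  induction b with
  | bot => simp at hb
  | top => simp [expDecay_top ha, Real.exp_pos]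
  | coe s => simp [expDecay_coe, mul_lt_mul_iff_right₀ ha]

lemma expDecay_le_mul (ha : 0 < a) (hb : 0 ≤ b) (hb' : 0 ≤ b')
    (h : ∀ r : ℝ, (r : EReal) < b → ((r - c : ℝ) : EReal) ≤ b') :
    expDecay a b' ≤ Real.exp (a * c) * expDecay a b := by
  induction b' with
  | bot => simp at hb'
  | top =>
    rw [expDecay_top ha]
    exact mul_nonneg (Real.exp_pos _).le expDecay_nonneg
  | coe s =>
    induction b with
    | bot => simp at hb
    | top =>
      have := EReal.coe_le_coe_iff.1 (h (s + c + 1) (EReal.coe_lt_top _))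
      linarith
    | coe r =>
      have hr : r ≤ s + c := le_of_forall_lt fun q hq => by
        by_contra! hq'
        have := EReal.coe_le_coe_iff.1 (h ((q + r) / 2) (EReal.coe_lt_coe_iff.2 (by linarith)))
        linarith
      rw [expDecay_coe, expDecay_coe, ← Real.exp_add, Real.exp_le_exp]
      nlinarith

lemma expDecay_rpow (ha : 0 < a) (ha' : 0 < a') (hb : 0 ≤ b) :
    expDecay a b ^ (a' / a) = expDecay a' b := by
  induction b with
  | bot => simp at hb
  | top => rw [expDecay_top ha, expDecay_top ha', Real.zero_rpow (div_pos ha' ha).ne']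
  | coe r =>
    rw [expDecay_coe, expDecay_coe, ← Real.exp_mul]
    congr 1
    field_simp

end ExpDecay

section Visual

variable {X : Type u} [MetricSpace X] {δ : ℝ}

lemma le_boundaryGromovProduct_of_lt₃ (hX : IsGromovHyperbolic δ X) {x : X}
    {z₁ z₂ z₃ z₄ : GromovBoundary X} {r : ℝ} (h₁ : (r : EReal) < boundaryGromovProduct x z₁ z₂)
    (h₂ : (r : EReal) < boundaryGromovProduct x z₂ z₃)
    (h₃ : (r : EReal) < boundaryGromovProduct x z₃ z₄) :
    ((r - 4 * δ : ℝ) : EReal) ≤ boundaryGromovProduct x z₁ z₄ := by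
  obtain ⟨s₁, hs₁⟩ := exists_convergesToBoundary z₁
  obtain ⟨s₂, hs₂⟩ := exists_convergesToBoundary z₂
  obtain ⟨s₃, hs₃⟩ := exists_convergesToBoundary z₃
  obtain ⟨s₄, hs₄⟩ := exists_convergesToBoundary z₄
  obtain ⟨N₁, hN₁⟩ := exists_le_gromovProduct hX hs₁ hs₂ h₁
  obtain ⟨N₂, hN₂⟩ := exists_le_gromovProduct hX hs₂ hs₃ h₂
  obtain ⟨N₃, hN₃⟩ := exists_le_gromovProduct hX hs₃ hs₄ h₃
  refine le_boundaryGromovProduct hs₁ hs₄ (N := max N₁ (max N₂ N₃)) fun n hn m hm => ?_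
  simp only [ge_iff_le, max_le_iff] at hn hm
  have := hX.le_trans₃ (hN₁ n hn.1 (max N₁ N₂) (le_max_left _ _))
    (hN₂ (max N₁ N₂) (le_max_right _ _) (max N₂ N₃) (le_max_left _ _))
    (hN₃ (max N₂ N₃) (le_max_right _ _) m hm.2.2)
  linarith

/-- Visual metrics exist: for `a = log 2 / (4 δ + 1)` the function `exp (-a (z, z')_x)` satisfies
the quasi-ultrametric inequality with constant `2` along chains of three steps, hence is comparable
to a distance by Frink's metrization lemma. -/
theorem exists_isVisualMetric (hX : IsGromovHyperbolic δ X) (x : X) :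
    ∃ (a : ℝ) (D : MetricSpace (GromovBoundary X)), IsVisualMetric δ x a D := by
  have hδ := hX.1
  have hlog : 0 < Real.log 2 := Real.log_pos one_lt_two
  obtain ⟨a, ha⟩ : ∃ a : ℝ, a = Real.log 2 / (4 * δ + 1) := ⟨_, rfl⟩
  have ha0 : 0 < a := by rw [ha]; positivity
  have ha1 : a * (4 * δ + 1) = Real.log 2 := by rw [ha]; field_simp
  let B : GromovBoundary X → GromovBoundary X → EReal := boundaryGromovProduct x
  have hB : ∀ z z', 0 ≤ B z z' := boundaryGromovProduct_nonneg x
  let q : GromovBoundary X → GromovBoundary X → ℝ≥0 := fun z z' =>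
    ⟨expDecay a (B z z'), expDecay_nonneg⟩
  have hq0 : ∀ z z', (q z z' : ℝ) = 0 ↔ z = z' := fun z z' =>
    (expDecay_eq_zero_iff ha0 (hB z z')).trans (boundaryGromovProduct_eq_top_iff hX)
  have hself : ∀ z, q z z = 0 := fun z => NNReal.coe_eq_zero.1 ((hq0 z z).2 rfl)
  have hcomm : ∀ z z', q z z' = q z' z := fun z z' =>
    NNReal.eq (congrArg (expDecay a) (boundaryGromovProduct_comm x z z'))
  have hquad : ∀ z₁ z₂ z₃ z₄, q z₁ z₄ ≤ 2 * max (q z₁ z₂) (max (q z₂ z₃) (q z₃ z₄)) := by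
    intro z₁ z₂ z₃ z₄
    let b := min (B z₁ z₂) (min (B z₂ z₃) (B z₃ z₄))
    have hb : 0 ≤ b := le_min (hB _ _) (le_min (hB _ _) (hB _ _))
    have h₁ : expDecay a (B z₁ z₄) ≤ Real.exp (a * (4 * δ)) * expDecay a b := by
      refine expDecay_le_mul ha0 hb (hB _ _) fun r hr => ?_
      simp only [b, lt_min_iff] at hr
      exact le_boundaryGromovProduct_of_lt₃ hX hr.1 hr.2.1 hr.2.2
    have h₂ : Real.exp (a * (4 * δ)) ≤ 2 := by
      rw [← Real.exp_log two_pos, Real.exp_le_exp, ← ha1]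
      linarith
    have h₃ : expDecay a b ≤ max (q z₁ z₂ : ℝ) (max (q z₂ z₃) (q z₃ z₄)) := by
      rcases min_choice (B z₁ z₂) (min (B z₂ z₃) (B z₃ z₄)) with h | h
      · simp only [b, h]
        exact le_max_left _ _
      rcases min_choice (B z₂ z₃) (B z₃ z₄) with h' | h' <;> simp only [b, h, h']
      · exact (le_max_left _ _).trans (le_max_right _ _)
      · exact (le_max_right _ _).trans (le_max_right _ _)
    rw [← NNReal.coe_le_coe]
    push_cast
    exact h₁.trans (mul_le_mul h₂ h₃ expDecay_nonneg zero_le_two)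
  have hle := PseudoMetricSpace.dist_ofPreNNDist_le q hself hcomm
  have hge := PseudoMetricSpace.le_two_mul_dist_ofPreNNDist q hself hcomm hquad
  let D : MetricSpace (GromovBoundary X) :=
    { PseudoMetricSpace.ofPreNNDist q hself hcomm with
      eq_of_dist_eq_zero := fun {z z'} h => by
        refine (hq0 z z').1 (le_antisymm ?_ (q z z').2)
        have := hge z z'
        rwa [show @dist _ (PseudoMetricSpace.ofPreNNDist q hself hcomm).toDist z z' = 0 from h,
          mul_zero] at this }
  refine ⟨a, D, ha0, ?_, 2, two_pos, fun z z' => ⟨?_, ?_⟩⟩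
  · have : Real.logb 2 (Real.exp 1) = 1 / Real.log 2 := by
      rw [Real.logb, Real.log_exp]
    rw [this, mul_one_div, ← mul_div_assoc, div_lt_one hlog, ← ha1]
    nlinarith
  · have : expDecay a (B z z') ≤ 2 * D.dist z z' := hge z z'
    change 1 / 2 * expDecay a (B z z') ≤ _
    linarith
  · have : D.dist z z' ≤ expDecay a (B z z') := hle z z'
    change _ ≤ 2 * expDecay a (B z z')
    linarith [expDecay_nonneg (a := a) (b := B z z')]

lemma IsVisualMetric.toTopologicalSpace_eq (hX : IsGromovHyperbolic δ X) {x : X} {a : ℝ}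
    {D : MetricSpace (GromovBoundary X)} (hD : IsVisualMetric δ x a D) :
    D.toUniformSpace.toTopologicalSpace = gromovBoundaryTopology X := by
  obtain ⟨ha, -, V, hV, h⟩ := hD
  refine TopologicalSpace.ext (funext fun U => propext ?_)
  refine (@Metric.isOpen_iff _ D.toPseudoMetricSpace U).trans ⟨fun hU x' z hz => ?_,
    fun hU z hz => ?_⟩
  · obtain ⟨ε, hε, hU⟩ := hU z hz
    have hε' : 0 < ε / V := div_pos hε hV
    refine ⟨-Real.log (ε / V) / a + (2 * δ + dist x' x) + 1, fun z' hz' => hU ?_⟩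
    have h₁ := le_boundaryGromovProduct_of_lt hX x' x hz'
    have h₂ : ((-Real.log (ε / V) / a : ℝ) : EReal) < boundaryGromovProduct x z z' :=
      (EReal.coe_lt_coe_iff.2 (by linarith)).trans_le h₁
    rw [← expDecay_lt_exp_iff ha (boundaryGromovProduct_nonneg _ _ _),
      mul_div_cancel₀ _ ha.ne', neg_neg, Real.exp_log hε', lt_div_iff₀' hV] at h₂
    rw [@Metric.mem_ball']
    exact (h z z').2.trans_lt h₂
  · obtain ⟨r, hr⟩ := hU x z hz
    refine ⟨1 / V * Real.exp (-(a * r)), by positivity, fun z' hz' => hr z' ?_⟩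
    rw [@Metric.mem_ball'] at hz'
    rw [← expDecay_lt_exp_iff ha (boundaryGromovProduct_nonneg _ _ _)]
    exact lt_of_mul_lt_mul_left ((h z z').1.trans_lt hz') (by positivity)

end Visual

/-! ### Geodesic segments and lines in proper spaces -/

section Geodesic

variable {X : Type u} [MetricSpace X] {δ : ℝ}

/-- Ultralimits of almost isometric maps: in a proper space, maps that are asymptotically isometric
on `S` and keep the image of `0` bounded converge, along a fixed nonprincipal ultrafilter, to a map
that is isometric on `S`. -/
lemma exists_isometric_ultralimit [ProperSpace X] {S : Set ℝ} (h0 : (0 : ℝ) ∈ S)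
    {g : ℕ → ℝ → X} {o : X} {R : ℝ} (hR : ∀ᶠ n in atTop, dist (g n 0) o ≤ R)
    (h : ∀ s ∈ S, ∀ t ∈ S, Tendsto (fun n => dist (g n s) (g n t)) atTop (𝓝 |s - t|)) :
    ∃ γ : ℝ → X, (∀ s ∈ S, ∀ t ∈ S, dist (γ s) (γ t) = |s - t|) ∧
      ∀ t ∈ S, Tendsto (fun n => g n t) (hyperfilter ℕ : Filter ℕ) (𝓝 (γ t)) := by
  have key : ∀ t : ℝ, ∃ p : X,
      t ∈ S → Tendsto (fun n => g n t) (hyperfilter ℕ : Filter ℕ) (𝓝 p) := by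
    intro t
    by_cases ht : t ∈ S
    · have hev : ∀ᶠ n in atTop, g n t ∈ Metric.closedBall o (|t - 0| + 1 + R) := by
        filter_upwards [hR, (h t ht 0 h0).eventually_le_const (lt_add_one _)] with n h₁ h₂
        exact (dist_triangle _ (g n 0) _).trans (add_le_add h₂ h₁)
      obtain ⟨p, -, hp⟩ := (isCompact_closedBall o (|t - 0| + 1 + R)).ultrafilter_le_nhds
        ((hyperfilter ℕ).map fun n => g n t)
        (le_principal_iff.2 (Nat.hyperfilter_le_atTop hev))
      exact ⟨p, fun _ => hp⟩
    · exact ⟨o, fun h => absurd h ht⟩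
  choose γ hγ using key
  refine ⟨γ, fun s hs t ht => ?_, hγ⟩
  exact tendsto_nhds_unique ((hγ s hs).dist (hγ t ht))
    ((h s hs t ht).mono_left Nat.hyperfilter_le_atTop)

/-- A chain of `n + 1` steps of equal length from `x` to `y`, obtained by applying the pointwise
form of geodesicity to the last point of the chain and `y`. -/
lemma IsGeodesicSpace.exists_chain (hX : IsGeodesicSpace X) (x y : X) (n : ℕ) :
    ∃ p : ℕ → X, p 0 = x ∧ p (n + 1) = y ∧ ∀ i j : ℕ, i ≤ j → j ≤ n + 1 →
      dist (p i) (p j) = (j - i) * (dist x y / (n + 1)) := by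
  obtain ⟨e, he⟩ : ∃ e, e = dist x y / (n + 1) := ⟨_, rfl⟩
  have he0 : 0 ≤ e := by rw [he]; positivity
  have hL : dist x y = (n + 1) * e := by rw [he]; field_simp
  have hstep : ∀ p : X, ∃ z, e ≤ dist p y → dist p z = e ∧ dist y z = dist p y - e := by
    intro p
    by_cases hp : e ≤ dist p y
    · obtain ⟨z, h₁, h₂⟩ := hX p y e ⟨he0, hp⟩
      exact ⟨z, fun _ => ⟨sub_eq_zero.1 (abs_nonpos_iff.1 h₁),
        sub_eq_zero.1 (abs_nonpos_iff.1 h₂)⟩⟩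
    · exact ⟨p, fun h => absurd h hp⟩
  choose f hf using hstep
  have hy : ∀ i : ℕ, i ≤ n + 1 → dist (f^[i] x) y = (n + 1 - i) * e := by
    intro i
    induction i with
    | zero => intro _; simp [hL]
    | succ i ih =>
      intro hi
      have hi' : ((i : ℝ) + 1) ≤ n + 1 := by exact_mod_cast hi
      have h := ih (by omega)
      rw [Function.iterate_succ_apply', dist_comm, (hf _ (by rw [h]; nlinarith)).2, h]
      push_cast
      ring
  have hle : ∀ i j : ℕ, i ≤ j → j ≤ n + 1 → dist (f^[i] x) (f^[j] x) ≤ (j - i) * e := by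
    intro i j hij
    induction j, hij using Nat.le_induction with
    | base => simp
    | succ j hij ih =>
      intro hj
      have hj' : ((j : ℝ) + 1) ≤ n + 1 := by exact_mod_cast hj
      have h := (hf _ (by rw [hy j (by omega)]; nlinarith)).1
      have h₂ := dist_triangle (f^[i] x) (f^[j] x) (f^[j + 1] x)
      rw [Function.iterate_succ_apply'] at h₂ ⊢
      push_cast
      linarith [ih (by omega)]
  refine ⟨fun i => f^[i] x, rfl, ?_, fun i j hij hj => ?_⟩
  · refine dist_eq_zero.1 ((hy (n + 1) le_rfl).trans ?_)
    simp
  · rw [← he]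
    refine le_antisymm (hle i j hij hj) ?_
    have := dist_triangle (f^[i] x) (f^[j] x) y
    rw [hy i (hij.trans hj), hy j hj] at this
    linarith

lemma IsGeodesicSpace.exists_almost_isometric (hX : IsGeodesicSpace X) (x y : X) (n : ℕ) :
    ∃ g : ℝ → X, g 0 = x ∧ g (dist x y) = y ∧ ∀ s ∈ Set.Icc 0 (dist x y),
      ∀ t ∈ Set.Icc 0 (dist x y), ‖dist (g s) (g t) - |s - t|‖ ≤ dist x y / (n + 1) := by
  rcases eq_or_ne x y with rfl | hxy
  · refine ⟨fun _ => x, rfl, rfl, fun s hs t ht => ?_⟩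
    simp only [dist_self, Set.Icc_self, Set.mem_singleton_iff] at hs ht
    simp [hs, ht]
  obtain ⟨p, hp0, hp1, hp⟩ := hX.exists_chain x y n
  have hL : 0 < dist x y := dist_pos.2 hxy
  obtain ⟨e, he⟩ : ∃ e, e = dist x y / (n + 1) := ⟨_, rfl⟩
  have he0 : 0 < e := by rw [he]; positivity
  have hL' : dist x y / e = ((n + 1 : ℕ) : ℝ) := by rw [he]; push_cast; field_simp
  rw [← he] at hp
  have hk : ∀ t ∈ Set.Icc 0 (dist x y),
      ⌊t / e⌋₊ ≤ n + 1 ∧ ⌊t / e⌋₊ * e ≤ t ∧ t ≤ (⌊t / e⌋₊ + 1) * e := by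
    intro t ht
    refine ⟨?_, ?_, ?_⟩
    · rw [← Nat.floor_natCast (R := ℝ) (n + 1), ← hL']
      exact Nat.floor_le_floor (div_le_div_of_nonneg_right ht.2 he0.le)
    · exact (le_div_iff₀ he0).1 (Nat.floor_le (div_nonneg ht.1 he0.le))
    · exact ((div_lt_iff₀ he0).1 (Nat.lt_floor_add_one _)).le
  have key : ∀ s ∈ Set.Icc 0 (dist x y), ∀ t ∈ Set.Icc 0 (dist x y), s ≤ t →
      ‖dist (p ⌊s / e⌋₊) (p ⌊t / e⌋₊) - |s - t|‖ ≤ e := by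
    intro s hs t ht hst
    rw [hp _ _ (Nat.floor_le_floor (div_le_div_of_nonneg_right hst he0.le)) (hk t ht).1,
      abs_sub_comm, abs_of_nonneg (sub_nonneg.2 hst), Real.norm_eq_abs, abs_le]
    constructor <;> linarith [(hk t ht).2, (hk s hs).2]
  refine ⟨fun t => p ⌊t / e⌋₊, by simpa using hp0, ?_, fun s hs t ht => ?_⟩
  · simp only [hL', Nat.floor_natCast, hp1]
  · rw [← he]
    rcases le_total s t with h | h
    · exact key s hs t ht h
    · rw [dist_comm, abs_sub_comm]
      exact key t ht s hs h

theorem IsGeodesicSpace.exists_segment [ProperSpace X] (hX : IsGeodesicSpace X) (x y : X) :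
    ∃ σ : ℝ → X, σ 0 = x ∧ σ (dist x y) = y ∧ ∀ s ∈ Set.Icc 0 (dist x y),
      ∀ t ∈ Set.Icc 0 (dist x y), dist (σ s) (σ t) = |s - t| := by
  choose g hg0 hg1 hg using hX.exists_almost_isometric x y
  have h0 : (0 : ℝ) ∈ Set.Icc 0 (dist x y) := ⟨le_rfl, dist_nonneg⟩
  have h1 : dist x y ∈ Set.Icc 0 (dist x y) := ⟨dist_nonneg, le_rfl⟩
  have hlim : Tendsto (fun n : ℕ => dist x y / ((n : ℝ) + 1)) atTop (𝓝 0) :=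
    tendsto_const_nhds.div_atTop (tendsto_natCast_atTop_atTop.atTop_add tendsto_const_nhds)
  obtain ⟨σ, hσ, hlimσ⟩ := exists_isometric_ultralimit h0 (g := g) (o := x) (R := 0)
    (Eventually.of_forall fun n => by simp [hg0]) fun s hs t ht =>
      tendsto_sub_nhds_zero_iff.1 (squeeze_zero_norm (fun n => hg n s hs t ht) hlim)
  refine ⟨σ, ?_, ?_, hσ⟩
  · have := hlimσ 0 h0
    simp only [hg0] at this
    exact tendsto_nhds_unique this tendsto_const_nhds
  · have := hlimσ _ h1
    simp only [hg1] at this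
    exact tendsto_nhds_unique this tendsto_const_nhds

lemma Isometry.dist_eq_abs_sub {γ : ℝ → X} (hγ : Isometry γ) (s t : ℝ) :
    dist (γ s) (γ t) = |s - t| := hγ.dist_eq s t

/-- Along a geodesic, `(γ s, γ t)` based at `γ 0` is the smaller of `s, t ≥ 0`. -/
lemma Isometry.le_gromovProduct {γ : ℝ → X} (hγ : Isometry γ) {r s t : ℝ} (hr : 0 ≤ r)
    (hs : r ≤ s) (ht : r ≤ t) : r ≤ gromovProduct (γ 0) (γ s) (γ t) := by
  unfold gromovProduct
  simp only [hγ.dist_eq_abs_sub, zero_sub, abs_neg]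
  rw [abs_of_nonneg (hr.trans hs), abs_of_nonneg (hr.trans ht)]
  rcases abs_cases (s - t) with h | h <;> linarith

lemma Isometry.gromovProductsTendTo {γ : ℝ → X} (hγ : Isometry γ) :
    GromovProductsTendTo (fun n : ℕ => γ n) (fun n : ℕ => γ n) := by
  refine (gromovProductsTendTo_iff (γ 0)).2 fun R => ⟨⌈R⌉₊, fun n hn m hm => ?_⟩
  refine (Nat.le_ceil R).trans (hγ.le_gromovProduct (Nat.cast_nonneg _) ?_ ?_)
  · exact_mod_cast hn
  · exact_mod_cast hm

lemma Isometry.comp_neg {γ : ℝ → X} (hγ : Isometry γ) : Isometry fun t => γ (-t) :=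
  hγ.comp (IsometryEquiv.neg ℝ).isometry

lemma Isometry.comp_add {γ : ℝ → X} (hγ : Isometry γ) (c : ℝ) : Isometry fun t => γ (t + c) :=
  hγ.comp (isometry_add_right c)

/-- The endpoint of a geodesic does not change when its parameter is translated. -/
lemma ConvergesToBoundary.comp_add (hX : IsGromovHyperbolic δ X) {γ : ℝ → X} (hγ : Isometry γ)
    {z : GromovBoundary X} (h : ConvergesToBoundary (fun n : ℕ => γ n) z) (c : ℝ) :
    ConvergesToBoundary (fun n : ℕ => γ (n + c)) z := by
  refine h.congr hX ((gromovProductsTendTo_iff (γ 0)).2 fun R => ?_)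
  refine ⟨⌈R⌉₊ + ⌈|c|⌉₊, fun n hn m hm => ?_⟩
  have h₁ : (⌈R⌉₊ : ℝ) + ⌈|c|⌉₊ ≤ n := by exact_mod_cast hn
  have h₂ : (⌈R⌉₊ : ℝ) + ⌈|c|⌉₊ ≤ m := by exact_mod_cast hm
  have h₃ := Nat.le_ceil |c|
  refine (Nat.le_ceil R).trans (hγ.le_gromovProduct (Nat.cast_nonneg _) ?_ ?_)
  · linarith [abs_nonneg c]
  · linarith [neg_abs_le c]

lemma IsGeodesicLineJoining.comp_add (hX : IsGromovHyperbolic δ X) {γ : ℝ → X}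
    {z z' : GromovBoundary X} (h : IsGeodesicLineJoining γ z z') (c : ℝ) :
    IsGeodesicLineJoining (fun t => γ (t + c)) z z' := by
  refine ⟨h.1.comp_add c, h.2.1.comp_add hX h.1 c, ?_⟩
  have := ConvergesToBoundary.comp_add hX h.1.comp_neg h.2.2 (-c)
  simpa [neg_add, add_comm] using this

/-- A sequence `c` converges to the same boundary point as `s` as soon as each `c k` has, seen from
a basepoint, Gromov product at least `k - 1` with infinitely many of the points `s n`. -/
lemma ConvergesToBoundary.of_frequently_le (hX : IsGromovHyperbolic δ X) {o : X} {c s : ℕ → X}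
    {z : GromovBoundary X} (hs : ConvergesToBoundary s z)
    (h : ∀ k : ℕ, ∃ᶠ n in atTop, (k : ℝ) - 1 ≤ gromovProduct o (c k) (s n)) :
    ConvergesToBoundary c z := by
  refine hs.congr hX (GromovProductsTendTo.symm ((gromovProductsTendTo_iff o).2 fun R => ?_))
  obtain ⟨N, hN⟩ := (gromovProductsTendTo_iff o).1 (hs.gromovProductsTendTo hX hs) (R + δ)
  refine ⟨max N ⌈R + δ + 1⌉₊, fun k hk m hm => ?_⟩
  have hk' : R + δ ≤ k - 1 := by
    have h₁ := Nat.le_ceil (R + δ + 1)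
    have h₂ : (⌈R + δ + 1⌉₊ : ℝ) ≤ k := by exact_mod_cast (le_max_right _ _).trans hk
    linarith
  obtain ⟨n, hn, hn'⟩ := frequently_atTop.1 (h k) N
  have := hX.le_trans (hk'.trans hn') (hN n hn m ((le_max_left _ _).trans hm))
  linarith

lemma exists_gromovProduct_le_of_ne (hX : IsGromovHyperbolic δ X) {s t : ℕ → X}
    {z z' : GromovBoundary X} (hs : ConvergesToBoundary s z) (ht : ConvergesToBoundary t z')
    (hz : z ≠ z') (x : X) : ∃ R : ℝ, ∃ N, ∀ n ≥ N, ∀ m ≥ N,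
      gromovProduct x (s n) (t m) ≤ R := by
  have h : ¬ GromovProductsTendTo s t := fun h => hz (hs.unique ht h)
  rw [gromovProductsTendTo_iff x] at h
  push Not at h
  obtain ⟨R, h⟩ := h
  obtain ⟨N₁, h₁⟩ := (gromovProductsTendTo_iff x).1 (hs.gromovProductsTendTo hX hs) (R + 2 * δ)
  obtain ⟨N₂, h₂⟩ := (gromovProductsTendTo_iff x).1 (ht.gromovProductsTendTo hX ht) (R + 2 * δ)
  obtain ⟨n', hn', m', hm', hlt⟩ := h (max N₁ N₂)
  refine ⟨R + 2 * δ, max N₁ N₂, fun n hn m hm => ?_⟩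
  by_contra! hcon
  have := hX.le_trans₃
    (h₁ n' ((le_max_left _ _).trans hn') n ((le_max_left _ _).trans hn)) hcon.le
    (h₂ m ((le_max_right _ _).trans hm) m' ((le_max_right _ _).trans hm'))
  linarith

/-- Two distinct points of the boundary of a proper geodesic hyperbolic space are the endpoints of
a geodesic line: segments joining points of sequences that represent them pass near a fixed
basepoint, hence accumulate on such a line. -/
theorem IsGeodesicSpace.exists_isGeodesicLineJoining [ProperSpace X] (hgeod : IsGeodesicSpace X)
    (hX : IsGromovHyperbolic δ X) {z z' : GromovBoundary X} (hz : z ≠ z') :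
    ∃ γ : ℝ → X, IsGeodesicLineJoining γ z z' := by
  obtain ⟨s, hs⟩ := exists_convergesToBoundary z
  obtain ⟨t, ht⟩ := exists_convergesToBoundary z'
  obtain ⟨x, hx⟩ : ∃ x, x = s 0 := ⟨_, rfl⟩
  obtain ⟨R, N, hR⟩ := exists_gromovProduct_le_of_ne hX hs ht hz x
  choose σ hσ0 hσ1 hσ using fun n => hgeod.exists_segment (t n) (s n)
  -- The segment `σ n` from `t n` to `s n` is at time `τ n` within a bounded distance of `x`.
  let τ : ℕ → ℝ := fun n => gromovProduct (t n) x (s n)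
  let L : ℕ → ℝ := fun n => dist (t n) (s n)
  have hτ : ∀ n, τ n ∈ Set.Icc 0 (L n) := fun n => by
    refine ⟨gromovProduct_nonneg _ _ _, ?_⟩
    have := gromovProduct_nonneg (s n) x (t n)
    have h := dist_comm (t n) (s n)
    have h' := dist_comm (t n) x
    simp only [τ, L, gromovProduct] at *
    rw [dist_comm (s n) x] at *
    linarith
  have hl : ∀ n, (0 : ℝ) ∈ Set.Icc 0 (L n) := fun n => ⟨le_rfl, dist_nonneg⟩
  have hr : ∀ n, L n ∈ Set.Icc 0 (L n) := fun n => ⟨dist_nonneg, le_rfl⟩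
  have hdt : ∀ n, ∀ u ∈ Set.Icc 0 (L n), dist (t n) (σ n u) = u := fun n u hu => by
    nth_rewrite 1 [← hσ0 n]
    rw [hσ n 0 (hl n) u hu, zero_sub, abs_neg, abs_of_nonneg hu.1]
  have hds : ∀ n, ∀ u ∈ Set.Icc 0 (L n), dist (σ n u) (s n) = L n - u := fun n u hu => by
    rw [show dist (σ n u) (s n) = dist (σ n u) (σ n (L n)) from
      congrArg (dist (σ n u)) (hσ1 n).symm, hσ n u hu _ (hr n), abs_sub_comm, abs_of_nonneg (sub_nonneg.2 hu.2)]
  have hxr : ∀ n ≥ N, dist x (σ n (τ n)) ≤ R + 2 * δ := fun n hn => by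
    refine (hX.dist_le_gromovProduct_add (hdt n _ (hτ n)) (hds n _ (hτ n))).trans ?_
    rw [gromovProduct_comm]
    linarith [hR n hn n hn]
  have hfar : ∀ {v : ℕ → X} {w : GromovBoundary X}, ConvergesToBoundary v w → ∀ A : ℝ,
      ∃ M, ∀ n ≥ M, A ≤ dist x (v n) := fun {v w} hv A => by
    obtain ⟨M, hM⟩ := (gromovProductsTendTo_iff x).1 (hv.gromovProductsTendTo hX hv) A
    exact ⟨M, fun n hn => by simpa [gromovProduct_self] using hM n hn n hn⟩
  have hdom : ∀ u : ℝ, ∀ᶠ n in atTop, τ n + u ∈ Set.Icc 0 (L n) := fun u => by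
    obtain ⟨M₁, hM₁⟩ := hfar hs (R + 2 * δ + |u|)
    obtain ⟨M₂, hM₂⟩ := hfar ht (R + 2 * δ + |u|)
    filter_upwards [eventually_ge_atTop N, eventually_ge_atTop M₁, eventually_ge_atTop M₂]
      with n h₁ h₂ h₃
    have e₁ := dist_triangle x (σ n (τ n)) (s n)
    have e₂ := dist_triangle_right x (t n) (σ n (τ n))
    rw [hds n _ (hτ n)] at e₁
    rw [hdt n _ (hτ n)] at e₂
    constructor <;> linarith [hM₁ n h₂, hM₂ n h₃, hxr n h₁, neg_abs_le u, le_abs_self u]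
  obtain ⟨γ, hγ, hlim⟩ := exists_isometric_ultralimit (Set.mem_univ 0)
    (g := fun n u => σ n (τ n + u)) (o := x) (R := R + 2 * δ)
    (by
      filter_upwards [eventually_ge_atTop N] with n hn
      rw [dist_comm, add_zero]
      exact hxr n hn)
    (fun u _ v _ => by
      refine tendsto_const_nhds.congr' ?_
      filter_upwards [hdom u, hdom v] with n hu hv
      rw [hσ n _ hu _ hv, add_sub_add_left_eq_sub])
  have hγ' : Isometry γ := Isometry.of_dist_eq fun u v => hγ u trivial v trivial
  -- Infinitely many of the segments are close to `γ` at any two given times.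
  have hclose : ∀ u v : ℝ, ∃ᶠ n in atTop, τ n + u ∈ Set.Icc 0 (L n) ∧
      τ n + v ∈ Set.Icc 0 (L n) ∧ dist (σ n (τ n + u)) (γ u) < 1 ∧
      dist (σ n (τ n + v)) (γ v) < 1 := fun u v => by
    refine Frequently.filter_mono (Eventually.frequently ?_) Nat.hyperfilter_le_atTop
    exact ((hdom u).filter_mono Nat.hyperfilter_le_atTop).and
      (((hdom v).filter_mono Nat.hyperfilter_le_atTop).and (((Metric.tendsto_nhds.1 (hlim u trivial)) 1 one_pos).and
        ((Metric.tendsto_nhds.1 (hlim v trivial)) 1 one_pos)))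
  refine ⟨γ, hγ', hs.of_frequently_le hX (o := γ 0) fun k => ?_,
    ht.of_frequently_le hX (o := γ 0) fun k => ?_⟩
  · refine (hclose k 0).mono fun n ⟨h₁, h₂, h₃, h₄⟩ => ?_
    have e₁ := hds n _ h₁
    have e₂ := hds n _ h₂
    have e₃ := hγ 0 trivial k trivial
    rw [zero_sub, abs_neg, Nat.abs_cast] at e₃
    have e₄ := dist_triangle_left (γ k) (s n) (σ n (τ n + k))
    have e₅ := dist_triangle (σ n (τ n + 0)) (γ 0) (s n)
    unfold gromovProduct
    linarith
  · refine (hclose (-k) 0).mono fun n ⟨h₁, h₂, h₃, h₄⟩ => ?_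
    have e₁ := hdt n _ h₁
    have e₂ := hdt n _ h₂
    have e₃ := hγ 0 trivial (-k) trivial
    rw [zero_sub, abs_neg, abs_neg, Nat.abs_cast] at e₃
    have e₄ := dist_triangle (t n) (σ n (τ n + -k)) (γ (-k))
    have e₅ := dist_triangle_right (t n) (σ n (τ n + 0)) (γ 0)
    unfold gromovProduct
    linarith [dist_comm (γ 0) (t n), dist_comm (γ (-k)) (t n)]

end Geodesic

/-! ### The quasiconvex hull of a closed subset of the boundary -/

section Hull

variable {X : Type u} [MetricSpace X] {δ : ℝ}

lemma mem_qcHull_iff (hX : IsGromovHyperbolic δ X) {C : Set (GromovBoundary X)} {p : X} :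
    p ∈ qcHull C ↔ ∃ (γ : ℝ → X) (z z' : GromovBoundary X),
      z ∈ C ∧ z' ∈ C ∧ IsGeodesicLineJoining γ z z' ∧ γ 0 = p := by
  constructor
  · rintro ⟨γ, z, z', hz, hz', hγ, c, rfl⟩
    exact ⟨_, z, z', hz, hz', hγ.comp_add hX c, by simp⟩
  · rintro ⟨γ, z, z', hz, hz', hγ, rfl⟩
    exact ⟨γ, z, z', hz, hz', hγ, 0, rfl⟩

/-- The endpoint of a geodesic belongs to the closed set `C` as soon as the geodesic is followed,
for arbitrarily long times, by geodesics with endpoint in `C`. -/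
lemma Isometry.endpoint_mem (hX : IsGromovHyperbolic δ X) {C : Set (GromovBoundary X)}
    (hC : IsClosed C) {γ : ℝ → X} (hγ : Isometry γ)
    (h : ∀ k : ℕ, ∃ c : ℝ → X, Isometry c ∧
      (∃ w ∈ C, ConvergesToBoundary (fun n : ℕ => c n) w) ∧
      dist (c 0) (γ 0) < 1 ∧ dist (c k) (γ k) < 1) :
    ∃ z ∈ C, ConvergesToBoundary (fun n : ℕ => γ n) z := by
  have hlim : ConvergesToBoundary (fun n : ℕ => γ n)
      (Quot.mk gromovRel ⟨_, hγ.gromovProductsTendTo⟩) := ⟨_, rfl⟩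
  refine ⟨_, hC.mem_of_gromovProduct_large (γ 0) fun r => ?_, hlim⟩
  obtain ⟨k, hk⟩ := exists_nat_ge (r + 2 + 2 * δ)
  obtain ⟨c, hc, ⟨w, hw, hcw⟩, h0, h1⟩ := h k
  refine ⟨w, hw, lt_of_lt_of_le (EReal.coe_lt_coe_iff.2 (lt_add_one r)) ?_⟩
  refine le_boundaryGromovProduct hlim hcw (N := k) fun n hn m hm => ?_
  have hn' : (k : ℝ) ≤ n := by exact_mod_cast hn
  have hm' : (k : ℝ) ≤ m := by exact_mod_cast hm
  have e₁ := hγ.le_gromovProduct k.cast_nonneg hn' le_rfl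
  have e₂ : (k : ℝ) - 1 ≤ gromovProduct (γ 0) (γ k) (c k) := by
    have a₁ := hγ.dist_eq_abs_sub 0 k
    have a₂ := hc.dist_eq_abs_sub 0 k
    rw [zero_sub, abs_neg, Nat.abs_cast] at a₁ a₂
    have a₃ := dist_triangle (c 0) (γ 0) (c k)
    unfold gromovProduct
    linarith [dist_comm (γ k) (c k)]
  have e₃ := hc.le_gromovProduct k.cast_nonneg le_rfl hm'
  have e₄ := gromovProduct_le_add_dist (c 0) (γ 0) (c k) (c m)
  have := hX.le_trans₃ (r := (k : ℝ) - 1) (by linarith) e₂ (by linarith : _ ≤ _)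
  linarith

theorem isClosed_qcHull [ProperSpace X] (hX : IsGromovHyperbolic δ X)
    {C : Set (GromovBoundary X)} (hC : IsClosed C) : IsClosed (qcHull C) := by
  refine IsSeqClosed.isClosed fun p q hp hq => ?_
  choose g z z' hz hz' hg hg0 using fun n => (mem_qcHull_iff hX).1 (hp n)
  obtain ⟨γ, hγ, hlim⟩ := exists_isometric_ultralimit (Set.mem_univ 0) (g := g) (o := q) (R := 1)
    (by
      filter_upwards [Metric.tendsto_nhds.1 hq 1 one_pos] with n hn
      rw [hg0]
      exact hn.le)
    (fun s _ t _ => by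
      simp only [(hg _).1.dist_eq_abs_sub]
      exact tendsto_const_nhds)
  have hγ' : Isometry γ := Isometry.of_dist_eq fun u v => hγ u trivial v trivial
  have hclose : ∀ u : ℝ, ∃ n, dist (g n 0) (γ 0) < 1 ∧ dist (g n u) (γ u) < 1 := fun u =>
    (((Metric.tendsto_nhds.1 (hlim 0 trivial)) 1 one_pos).and
      ((Metric.tendsto_nhds.1 (hlim u trivial)) 1 one_pos)).exists
  obtain ⟨w, hw, hγw⟩ := hγ'.endpoint_mem hX hC fun k => by
    obtain ⟨n, hn⟩ := hclose k
    exact ⟨g n, (hg n).1, ⟨z n, hz n, (hg n).2.1⟩, hn⟩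
  obtain ⟨w', hw', hγw'⟩ := hγ'.comp_neg.endpoint_mem hX hC fun k => by
    obtain ⟨n, hn⟩ := hclose (-k)
    exact ⟨_, (hg n).1.comp_neg, ⟨z' n, hz' n, (hg n).2.2⟩, by simpa using hn⟩
  refine (mem_qcHull_iff hX).2 ⟨γ, w, w', hw, hw', ⟨hγ', hγw, hγw'⟩, ?_⟩
  have := hlim 0 trivial
  simp only [hg0] at this
  exact tendsto_nhds_unique this (hq.mono_left Nat.hyperfilter_le_atTop)

/-- A Gromov product `(γ u, γ v)_m` is, up to `2δ`, at least the distance from `m` to `γ`. -/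
lemma Isometry.exists_dist_le (hX : IsGromovHyperbolic δ X) {γ : ℝ → X} (hγ : Isometry γ)
    {u v : ℝ} (huv : u ≤ v) (m : X) :
    ∃ w, dist m (γ w) ≤ gromovProduct m (γ u) (γ v) + 2 * δ := by
  have hd : dist (γ u) (γ v) = v - u := by
    rw [hγ.dist_eq_abs_sub, abs_sub_comm, abs_of_nonneg (sub_nonneg.2 huv)]
  have h0 := gromovProduct_nonneg (γ u) m (γ v)
  have h1 : gromovProduct (γ u) m (γ v) ≤ v - u := by
    rw [← hd]
    have := dist_triangle (γ u) (γ v) m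
    unfold gromovProduct
    linarith [dist_comm (γ v) m]
  refine ⟨u + gromovProduct (γ u) m (γ v), hX.dist_le_gromovProduct_add ?_ ?_⟩
  · rw [hγ.dist_eq_abs_sub, sub_add_cancel_left, abs_neg, abs_of_nonneg h0]
  · rw [hγ.dist_eq_abs_sub, hd, abs_sub_comm, abs_of_nonneg (by linarith)]
    ring

/-- A point `m` between two points `p`, `q` of the hull is within `6δ` of the hull: going from `p`
to `q` through infinity along two lines of the hull and the line joining their endpoints, the
four-point condition makes one of the Gromov products at `m` at most `4δ`. -/
theorem exists_mem_qcHull_dist_le [ProperSpace X] (hgeod : IsGeodesicSpace X)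
    (hX : IsGromovHyperbolic δ X) {C : Set (GromovBoundary X)} {p q m : X}
    (hp : p ∈ qcHull C) (hq : q ∈ qcHull C) (hm : gromovProduct m p q = 0) :
    ∃ r ∈ qcHull C, dist m r ≤ 6 * δ := by
  have hδ := hX.1
  obtain ⟨γ, b, b', hb, hb', hγ, rfl⟩ := (mem_qcHull_iff hX).1 hp
  obtain ⟨η, d, d', hd, hd', hη, rfl⟩ := (mem_qcHull_iff hX).1 hq
  by_cases h₁ : ∃ n : ℕ, gromovProduct m (γ 0) (γ n) ≤ 2 * δ
  · obtain ⟨n, hn⟩ := h₁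
    obtain ⟨w, hw⟩ := hγ.1.exists_dist_le hX n.cast_nonneg m
    exact ⟨γ w, ⟨γ, b, b', hb, hb', hγ, w, rfl⟩, by linarith⟩
  by_cases h₂ : ∃ n : ℕ, gromovProduct m (η 0) (η n) ≤ 2 * δ
  · obtain ⟨n, hn⟩ := h₂
    obtain ⟨w, hw⟩ := hη.1.exists_dist_le hX n.cast_nonneg m
    exact ⟨η w, ⟨η, d, d', hd, hd', hη, w, rfl⟩, by linarith⟩
  push Not at h₁ h₂
  -- The chain `p`, `γ i`, `η j`, `q` has a Gromov product at `m` at most `2δ`: the middle one.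
  have h₃ : ∀ i j : ℕ, gromovProduct m (γ i) (η j) ≤ 2 * δ := by
    intro i j
    by_contra! hlt
    have h₂' := h₂ j
    rw [gromovProduct_comm] at h₂'
    have := hX.le_trans₃ (r := min (gromovProduct m (γ 0) (γ i))
        (min (gromovProduct m (γ i) (η j)) (gromovProduct m (η j) (η 0))))
      (min_le_left _ _) ((min_le_right _ _).trans (min_le_left _ _))
      ((min_le_right _ _).trans (min_le_right _ _))
    linarith [lt_min (h₁ i) (lt_min hlt h₂')]
  have hbd : b ≠ d := by
    rintro rfl
    obtain ⟨N, hN⟩ := (gromovProductsTendTo_iff m).1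
      (hγ.2.1.gromovProductsTendTo hX hη.2.1) (2 * δ + 1)
    linarith [hN N le_rfl N le_rfl, h₃ N N]
  obtain ⟨σ, hσ⟩ := hgeod.exists_isGeodesicLineJoining hX hbd
  obtain ⟨N, hN⟩ := (gromovProductsTendTo_iff m).1
    (hγ.2.1.gromovProductsTendTo hX hσ.2.1) (4 * δ + 1)
  obtain ⟨M, hM⟩ := (gromovProductsTendTo_iff m).1
    (hσ.2.2.gromovProductsTendTo hX hη.2.1) (4 * δ + 1)
  obtain ⟨n, hn⟩ : ∃ n, n = max N M := ⟨_, rfl⟩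
  have h₄ : gromovProduct m (σ n) (σ (-n)) ≤ 4 * δ := by
    by_contra! hlt
    have e₁ := hN N le_rfl n (hn ▸ le_max_left _ _)
    have e₂ := hM n (hn ▸ le_max_right _ _) M le_rfl
    have := hX.le_trans₃ (r := min (4 * δ + 1) (gromovProduct m (σ n) (σ (-n))))
      ((min_le_left _ _).trans e₁) (min_le_right _ _) ((min_le_left _ _).trans e₂)
    linarith [lt_min (lt_add_one (4 * δ)) hlt, h₃ N M]
  rw [gromovProduct_comm] at h₄
  obtain ⟨w, hw⟩ := hσ.1.exists_dist_le hX (neg_le_self n.cast_nonneg : -(n : ℝ) ≤ n) m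
  exact ⟨σ w, ⟨σ, b, d, hb, hd, hσ, w, rfl⟩, by linarith⟩

theorem isAlmostGeodesic_qcHull [ProperSpace X] (hgeod : IsGeodesicSpace X)
    (hX : IsGromovHyperbolic δ X) (C : Set (GromovBoundary X)) :
    IsAlmostGeodesic (6 * δ) (qcHull C) := by
  intro p q t ht
  obtain ⟨m, h₁, h₂⟩ := hgeod p.1 q.1 t ht
  have e₁ := sub_eq_zero.1 (abs_nonpos_iff.1 h₁)
  have e₂ := sub_eq_zero.1 (abs_nonpos_iff.1 h₂)
  obtain ⟨r, hr, hmr⟩ := exists_mem_qcHull_dist_le hgeod hX p.2 q.2 (m := m) (by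
    rw [gromovProduct, dist_comm m, dist_comm m, e₁, e₂]
    ring)
  refine ⟨⟨r, hr⟩, ?_, ?_⟩
  · rw [Subtype.dist_eq, ← e₁, abs_sub_comm, dist_comm p.1, dist_comm p.1]
    exact (abs_dist_sub_le _ _ _).trans hmr
  · rw [Subtype.dist_eq, Subtype.dist_eq, ← e₂, abs_sub_comm, dist_comm q.1, dist_comm q.1]
    exact (abs_dist_sub_le _ _ _).trans hmr

lemma IsAlmostGeodesic.mono {K K' : ℝ} (h : IsAlmostGeodesic K X) (hK : K ≤ K') :
    IsAlmostGeodesic K' X := fun x y t ht => by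
  obtain ⟨z, h₁, h₂⟩ := h x y t ht
  exact ⟨z, h₁.trans hK, h₂.trans hK⟩

lemma IsGromovHyperbolic.subtype (hX : IsGromovHyperbolic δ X) (Y : Set X) :
    IsGromovHyperbolic δ Y :=
  ⟨hX.1, fun x y z w => hX.2 x y z w⟩

end Hull

/-! ### The boundary of a subspace -/

section Inclusion

variable {X : Type u} [MetricSpace X] {δ : ℝ} {Y : Set X}

lemma gromovProductsTendTo_coe_iff {s t : ℕ → Y} :
    GromovProductsTendTo (fun n => (s n : X)) (fun n => (t n : X)) ↔ GromovProductsTendTo s t :=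
  (gromovProductsTendTo_iff (s 0 : X)).trans (gromovProductsTendTo_iff (s 0)).symm

/-- The map `∂Y → ∂X` induced by the inclusion of a subspace `Y` of `X`. -/
def boundaryInclusion (Y : Set X) : GromovBoundary Y → GromovBoundary X :=
  Quot.map (fun s => ⟨fun n => (s.1 n : X), gromovProductsTendTo_coe_iff.2 s.2⟩)
    fun _ _ h => gromovProductsTendTo_coe_iff.2 h

lemma ConvergesToBoundary.coe {s : ℕ → Y} {z : GromovBoundary Y} (h : ConvergesToBoundary s z) :
    ConvergesToBoundary (fun n => (s n : X)) (boundaryInclusion Y z) := by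
  obtain ⟨h, rfl⟩ := h
  exact ⟨gromovProductsTendTo_coe_iff.2 h, rfl⟩

lemma boundaryInclusion_injective (hX : IsGromovHyperbolic δ X) :
    Function.Injective (boundaryInclusion Y) := by
  intro z z' h
  obtain ⟨s, hs⟩ := exists_convergesToBoundary z
  obtain ⟨t, ht⟩ := exists_convergesToBoundary z'
  exact hs.unique ht (gromovProductsTendTo_coe_iff.1
    (hs.coe.gromovProductsTendTo hX (h ▸ ht.coe)))

lemma le_boundaryGromovProduct_inclusion_of_lt (hX : IsGromovHyperbolic δ X) (y : Y) (x : X)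
    {z z' : GromovBoundary Y} {r : ℝ} (h : (r : EReal) < boundaryGromovProduct y z z') :
    ((r - (2 * δ + dist x y) : ℝ) : EReal) ≤
      boundaryGromovProduct x (boundaryInclusion Y z) (boundaryInclusion Y z') := by
  obtain ⟨s, hs⟩ := exists_convergesToBoundary z
  obtain ⟨t, ht⟩ := exists_convergesToBoundary z'
  obtain ⟨N, hN⟩ := exists_le_gromovProduct (hX.subtype Y) hs ht h
  refine le_boundaryGromovProduct hs.coe ht.coe (N := N) fun n hn m hm => ?_
  have h₁ : r - 2 * δ ≤ gromovProduct (y : X) (s n) (t m) := hN n hn m hm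
  linarith [gromovProduct_le_add_dist (y : X) x (s n) (t m), dist_comm x y]

lemma le_boundaryGromovProduct_of_lt_inclusion (hX : IsGromovHyperbolic δ X) (y : Y) (x : X)
    {z z' : GromovBoundary Y} {r : ℝ}
    (h : (r : EReal) < boundaryGromovProduct x (boundaryInclusion Y z) (boundaryInclusion Y z')) :
    ((r - (2 * δ + dist x y) : ℝ) : EReal) ≤ boundaryGromovProduct y z z' := by
  obtain ⟨s, hs⟩ := exists_convergesToBoundary z
  obtain ⟨t, ht⟩ := exists_convergesToBoundary z'
  obtain ⟨N, hN⟩ := exists_le_gromovProduct hX hs.coe ht.coe h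
  refine le_boundaryGromovProduct hs ht (N := N) fun n hn m hm => ?_
  change _ ≤ gromovProduct (y : X) (s n) (t m)
  linarith [hN n hn m hm, gromovProduct_le_add_dist x (y : X) (s n) (t m)]

/-- Gromov products on `∂Y` and on its image in `∂X` differ by a bounded amount. Hence visual
metrics `D` on `∂X`, `D'` on `∂Y` of parameters `a`, `a'` satisfy `D' ≍ D ^ (a' / a)`. -/
lemma isQuasisymmetricEquivalence_of_isVisualMetric (hX : IsGromovHyperbolic δ X)
    {C : Set (GromovBoundary X)} (E : C ≃ GromovBoundary Y)
    (hE : ∀ c, boundaryInclusion Y (E c) = c) {x : X} {a : ℝ} {D : MetricSpace (GromovBoundary X)}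
    (hD : IsVisualMetric δ x a D) {y : Y} {a' : ℝ} {D' : MetricSpace (GromovBoundary Y)}
    (hD' : IsVisualMetric δ y a' D') :
    @IsQuasisymmetricEquivalence C (GromovBoundary Y)
      (MetricSpace.induced Subtype.val Subtype.val_injective D) D' E := by
  obtain ⟨ha, -, V, hV, h⟩ := hD
  obtain ⟨ha', -, V', hV', h'⟩ := hD'
  have hp : 0 < a' / a := div_pos ha' ha
  let k : ℝ := Real.exp (a' * (2 * δ + dist x y))
  have hk : 0 < k := Real.exp_pos _
  have hVp : 0 < V ^ (a' / a) := Real.rpow_pos_of_pos hV _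
  let B : C → C → EReal := fun c c' => boundaryGromovProduct x c c'
  let B' : C → C → EReal := fun c c' => boundaryGromovProduct y (E c) (E c')
  have hB : ∀ c c', 0 ≤ B c c' := fun c c' => boundaryGromovProduct_nonneg _ _ _
  have hB' : ∀ c c', 0 ≤ B' c c' := fun c c' => boundaryGromovProduct_nonneg _ _ _
  have h₁ : ∀ c c', expDecay a' (B' c c') ≤ k * expDecay a (B c c') ^ (a' / a) := fun c c' => by
    rw [expDecay_rpow ha ha' (hB c c')]
    refine expDecay_le_mul ha' (hB c c') (hB' c c') fun r hr => ?_
    simp only [B, ← hE] at hr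
    exact le_boundaryGromovProduct_of_lt_inclusion hX y x hr
  have h₂ : ∀ c c', expDecay a (B c c') ^ (a' / a) ≤ k * expDecay a' (B' c c') := fun c c' => by
    rw [expDecay_rpow ha ha' (hB c c')]
    refine expDecay_le_mul ha' (hB' c c') (hB c c') fun r hr => ?_
    have := le_boundaryGromovProduct_inclusion_of_lt hX y x hr
    rwa [hE, hE] at this
  have hlow : ∀ c c' : C, expDecay a (B c c') ≤ V * D.dist c c' := fun c c' => by
    have := (h c c').1
    rwa [one_div, inv_mul_le_iff₀ hV] at this
  have hlow' : ∀ c c' : C, expDecay a' (B' c c') ≤ V' * D'.dist (E c) (E c') := fun c c' => by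
    have := (h' (E c) (E c')).1
    rwa [one_div, inv_mul_le_iff₀ hV'] at this
  have hD0 : ∀ z z', 0 ≤ D.dist z z' := fun z z' => @dist_nonneg _ D.toPseudoMetricSpace z z'
  refine @IsQuasisymmetricEquivalence.of_rpow _ _
    (MetricSpace.induced Subtype.val Subtype.val_injective D) D' E (a' / a)
    (V' * k * V ^ (a' / a)) hp (by positivity) (fun c c' => ?_) (fun c c' => ?_)
  · calc D'.dist (E c) (E c') ≤ V' * expDecay a' (B' c c') := (h' _ _).2
      _ ≤ V' * (k * (V * D.dist c c') ^ (a' / a)) := by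
        refine mul_le_mul_of_nonneg_left ((h₁ c c').trans ?_) hV'.le
        exact mul_le_mul_of_nonneg_left
          (Real.rpow_le_rpow expDecay_nonneg (hlow c c') hp.le) hk.le
      _ = V' * k * V ^ (a' / a) * D.dist c c' ^ (a' / a) := by
        rw [Real.mul_rpow hV.le (hD0 _ _)]
        ring
  · calc D.dist c c' ^ (a' / a) ≤ (V * expDecay a (B c c')) ^ (a' / a) :=
        Real.rpow_le_rpow (hD0 _ _) (h c c').2 hp.le
      _ = V ^ (a' / a) * expDecay a (B c c') ^ (a' / a) :=
        Real.mul_rpow hV.le expDecay_nonneg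
      _ ≤ V ^ (a' / a) * (k * (V' * D'.dist (E c) (E c'))) := by
        refine mul_le_mul_of_nonneg_left ((h₂ c c').trans ?_) hVp.le
        exact mul_le_mul_of_nonneg_left (hlow' c c') hk.le
      _ = V' * k * V ^ (a' / a) * D'.dist (E c) (E c') := by ring

/-- The boundary of the hull of `C` is `C`. A sequence `p n` of the hull converging to `z` lies on
lines with endpoints in `C`; seen from `p n` the Gromov product of the two ends of such a line is
`0`, so one of the ends is, seen from the basepoint, in the direction of `p n`. These ends converge
to `z`. -/
theorem range_boundaryInclusion_qcHull [ProperSpace X] (hgeod : IsGeodesicSpace X)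
    (hX : IsGromovHyperbolic δ X) {C : Set (GromovBoundary X)} (hclosed : IsClosed C)
    (hC : C.Nontrivial) : Set.range (boundaryInclusion (qcHull C)) = C := by
  refine Set.Subset.antisymm ?_ fun z hz => ?_
  · rintro _ ⟨z, rfl⟩
    obtain ⟨s, hs⟩ := exists_convergesToBoundary z
    obtain ⟨x, hx⟩ : ∃ x : X, x = s 0 := ⟨_, rfl⟩
    have hs' := hs.coe
    refine hclosed.mem_of_gromovProduct_large x fun r => ?_
    obtain ⟨N, hN⟩ := (gromovProductsTendTo_iff x).1 (hs'.gromovProductsTendTo hX hs')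
      (r + 1 + 3 * δ)
    obtain ⟨γ, b, b', hb, hb', hγ, h0⟩ := (mem_qcHull_iff hX).1 (s N).2
    have hfar : r + 1 + 3 * δ ≤ dist x (s N) := by
      simpa [gromovProduct_self] using hN N le_rfl N le_rfl
    -- An end of the line through `s N` that is seen from `x` in the direction of `s N`.
    have key : ∀ (c : ℕ → X) (w : GromovBoundary X), ConvergesToBoundary c w →
        (∃ᶠ n in atTop, gromovProduct (s N : X) x (c n) ≤ δ) →
        (r : EReal) < boundaryGromovProduct x (boundaryInclusion (qcHull C) z) w := by
      intro c w hc hfreq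
      obtain ⟨M, hM⟩ := (gromovProductsTendTo_iff x).1 (hc.gromovProductsTendTo hX hc)
        (r + 1 + 2 * δ)
      obtain ⟨n, hn, hle⟩ := frequently_atTop.1 hfreq M
      refine (EReal.coe_lt_coe_iff.2 (lt_add_one r)).trans_le
        (le_boundaryGromovProduct hs' hc (N := max N M) fun i hi j hj => ?_)
      have e : r + 1 + 2 * δ ≤ gromovProduct x (s N) (c n) := by
        unfold gromovProduct at *
        linarith [dist_comm (s N : X) x]
      have := hX.le_trans₃ (r := r + 1 + 2 * δ)
        (by linarith [hN i ((le_max_left _ _).trans hi) N le_rfl, hX.1]) e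
        (hM n hn j ((le_max_right _ _).trans hj))
      linarith
    by_cases hfreq : ∃ᶠ n : ℕ in atTop, gromovProduct (s N : X) x (γ n) ≤ δ
    · exact ⟨b, hb, key _ b hγ.2.1 hfreq⟩
    · refine ⟨b', hb', key _ b' hγ.2.2 (Eventually.frequently ?_)⟩
      filter_upwards [not_frequently.1 hfreq] with n hn
      by_contra! hlt
      rw [gromovProduct_comm] at hn
      push Not at hn
      have h₁ := lt_min hn hlt
      have h₂ := hX.2 (γ n) x (γ (-n)) (s N)
      have h₃ : gromovProduct (s N : X) (γ n) (γ (-n)) = 0 := by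
        simp only [gromovProduct, ← h0, hγ.1.dist_eq_abs_sub, zero_sub, abs_neg,
          sub_neg_eq_add, zero_add, Nat.abs_cast]
        rw [abs_of_nonneg (by positivity : (0 : ℝ) ≤ n + n)]
        ring
      linarith
  · obtain ⟨z', hz', hne⟩ := hC.exists_ne z
    obtain ⟨γ, hγ⟩ := hgeod.exists_isGeodesicLineJoining hX hne.symm
    let s : ℕ → qcHull C := fun n => ⟨γ n, γ, z, z', hz, hz', hγ, n, rfl⟩
    have hs : GromovProductsTendTo s s :=
      gromovProductsTendTo_coe_iff.1 hγ.1.gromovProductsTendTo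
    have hs' : ConvergesToBoundary s (Quot.mk gromovRel ⟨s, hs⟩) := ⟨hs, rfl⟩
    exact ⟨_, hs'.coe.unique hγ.2.1 hγ.1.gromovProductsTendTo⟩

end Inclusion

theorem mainTheorem9 {X : Type*} [MetricSpace X] [ProperSpace X] (hgeod : IsGeodesicSpace X)
    (δ : ℝ) (hδ : IsGromovHyperbolic δ X)
    (C : Set (GromovBoundary X)) (hclosed : IsClosed C) (hC : C.Nontrivial) :
    ProperSpace (qcHull C) ∧
    IsAlmostGeodesic (36 * δ) (qcHull C) ∧
    IsGromovHyperbolic δ (qcHull C) ∧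
    (subsetGauge δ C).Nonempty ∧
    (boundaryGauge δ (qcHull C)).Nonempty ∧
    ∃ F : C ≃ₜ GromovBoundary (qcHull C),
      ∀ d ∈ subsetGauge δ C, ∀ d' ∈ boundaryGauge δ (qcHull C),
        @IsQuasisymmetricEquivalence C (GromovBoundary (qcHull C)) d d' F := by
  have hhyp := hδ.subtype (qcHull C)
  have hrange := range_boundaryInclusion_qcHull hgeod hδ hclosed hC
  -- The inverse of the map induced by the inclusion of the hull, with values restricted to `C`.
  let E : C ≃ GromovBoundary (qcHull C) :=
    ((Equiv.ofInjective _ (boundaryInclusion_injective hδ)).trans (Equiv.setCongr hrange)).symm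
  have hE : ∀ c, boundaryInclusion (qcHull C) (E c) = c := fun c =>
    congrArg Subtype.val (E.symm_apply_apply c)
  obtain ⟨y⟩ : Nonempty (qcHull C) := by
    obtain ⟨c, hc⟩ := hC.nonempty
    obtain ⟨s, -⟩ := exists_convergesToBoundary (E ⟨c, hc⟩)
    exact ⟨s 0⟩
  obtain ⟨a, D, hD⟩ := exists_isVisualMetric hδ (y : X)
  obtain ⟨a', D', hD'⟩ := exists_isVisualMetric hhyp y
  have hcont : Continuous E ∧ Continuous E.symm := by
    have h := (isQuasisymmetricEquivalence_of_isVisualMetric hδ E hE hD hD').1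
    have h' := (@Equiv.isHomeomorph_iff _ _
      (TopologicalSpace.induced Subtype.val D.toUniformSpace.toTopologicalSpace)
      D'.toUniformSpace.toTopologicalSpace E).1 h
    rwa [hD.toTopologicalSpace_eq hδ, hD'.toTopologicalSpace_eq hhyp] at h'
  refine ⟨.of_isClosed (isClosed_qcHull hδ hclosed),
    (isAlmostGeodesic_qcHull hgeod hδ C).mono (by linarith [hδ.1]), hhyp, ?_, ?_, ?_⟩
  · exact ⟨_, y, a, D, hD, @IsQuasisymmetricEquivalence.id _
      (MetricSpace.induced Subtype.val Subtype.val_injective D)⟩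
  · exact ⟨D', y, a', D', hD', @IsQuasisymmetricEquivalence.id _ D'⟩
  · refine ⟨⟨E, hcont.1, hcont.2⟩, ?_⟩
    rintro d ⟨x, b, D₁, hD₁, hd⟩ d' ⟨x', b', D₂, hD₂, hd'⟩
    have h := isQuasisymmetricEquivalence_of_isVisualMetric hδ E hE hD₁ hD₂
    have h' := @IsQuasisymmetricEquivalence.symm _ _ d' D₂ (Equiv.refl _) hd'
    exact @IsQuasisymmetricEquivalence.comp _ _ _ d D₂ d' _ E h'
      (@IsQuasisymmetricEquivalence.comp _ _ _ d
        (MetricSpace.induced Subtype.val Subtype.val_injective D₁) D₂ E _ h hd)
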